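/- Let $p\ge 1$, $\theta,\alpha\in\mathbb{R}^p$, and let $(\varepsilon_t,\eta_{1,t},\dots,\eta_{p,t})_{t\in\mathbb{Z}}$ be an i.i.d. sequence of random vectors in $\mathbb{R}^{1+p}$. Consider the RCAR$(p)$ equation with MA(1) random coefficients $$X_t=\sum_{k=1}^p(\theta_k+\alpha_k\eta_{k,t-1}+\eta_{k,t})X_{t-k}+\varepsilon_t\quad\text{a.s.},\qquad t\in\mathbb{Z}. \tag{1}$$ Put $\Phi_t=(X_t,\dots,X_{t-p+1})^T$ and $E_t=(\varepsilon_t,0,\dots,0)^T$; let $N_t$ be the $p\times p$ matrix with first row $(\eta_{1,t},\dots,\eta_{p,t})$ and zeros elsewhere, $D_\alpha=\mathrm{diag}(\alpha_1,\dots,\alpha_p)$, let $C_\theta$ be the companion matrix (first row $\theta$, ones on the subdiagonal, zeros elsewhere), and let $A_t=C_\theta+N_{t-1}D_\alpha+N_t$. Let $\mathcal{F}_t=\sigma((\varepsilon_s,\eta_{1,s},\dots,\eta_{p,s}),\,s\le t)$. Assume that for some submultiplicative norm on the real $p\times p$ matrices $$\mathbb{E}[\ln\|C_\theta+N_0D_\alpha+N_1\|]<0\quad\text{and}\quad\mathbb{E}[\ln^+|\varepsilon_0|]<+\infty,$$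 where $\ln 0=-\infty$ and the first expectation may be $-\infty$. Then: (a) Equation (1) has a solution $(X_t)_{t\in\mathbb{Z}}$ that is $(\mathcal{F}_t)$-adapted, strictly stationary and ergodic and that satisfies, for all $t\in\mathbb{Z}$, almost surely, $$\Phi_t=E_t+\sum_{k=1}^{\infty}\Big(\prod_{\ell=0}^{k-1}A_{t-\ell}\Big)E_{t-k},\qquad \prod_{\ell=0}^{k-1}A_{t-\ell}=A_tA_{t-1}\cdots A_{t-k+1}, \tag{2}$$ the series being absolutely convergent. (b) Every solution $(X_t)_{t\in\mathbb{Z}}$ of (1) whose one-dimensional laws form a tight family (in particular every strictly stationary solution) satisfies (2), with the series absolutely convergent, for all $t\in\mathbb{Z}$ almost surely. Consequently, it is strictly stationary and ergodic, and each $X_t$ is almost surely equal to an $\mathcal{F}_t$-measurable random variable. -/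

import Mathlib

open MeasureTheory ProbabilityTheory
open scoped ENNReal

noncomputable section

namespace RCAR

/-- The companion matrix `C_θ`: first row `θ`, ones on the subdiagonal, zeros elsewhere. -/
def companion {p : ℕ} (θ : Fin p → ℝ) : Matrix (Fin p) (Fin p) ℝ :=
  Matrix.of fun i j => if i.val = 0 then θ j else if i.val = j.val + 1 then 1 else 0

/-- The `p × p` matrix with first row `v` and zeros elsewhere (`N_t` is obtained for `v = η_t`). -/
def rowMatrix {p : ℕ} (v : Fin p → ℝ) : Matrix (Fin p) (Fin p) ℝ :=
  Matrix.of fun i j => if i.val = 0 then v j else 0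

/-- The vector `(e, 0, …, 0)` of length `p` (`E_t` is obtained for `e = ε_t`). -/
def firstVec (p : ℕ) (e : ℝ) : Fin p → ℝ :=
  fun i => if i.val = 0 then e else 0

section Model

variable {Ω : Type*} {p : ℕ}

/-- The random coefficient matrix `A_t = C_θ + N_{t-1} D_α + N_t`. -/
def coeffMatrix (θ α : Fin p → ℝ) (η : ℤ → Ω → Fin p → ℝ) (t : ℤ) (ω : Ω) :
    Matrix (Fin p) (Fin p) ℝ :=
  companion θ + rowMatrix (η (t - 1) ω) * Matrix.diagonal α + rowMatrix (η t ω)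

/-- The ordered product `A_t A_{t-1} ⋯ A_{t-k+1}` (the factor `ℓ = 0` is leftmost). -/
def coeffProd (θ α : Fin p → ℝ) (η : ℤ → Ω → Fin p → ℝ) (t : ℤ) (k : ℕ) (ω : Ω) :
    Matrix (Fin p) (Fin p) ℝ :=
  ((List.range k).map fun ℓ => coeffMatrix θ α η (t - (ℓ : ℤ)) ω).prod

/-- The `k`-th term `A_t A_{t-1} ⋯ A_{t-k+1} E_{t-k}` of the causal series. -/
def causalTerm (θ α : Fin p → ℝ) (ε : ℤ → Ω → ℝ) (η : ℤ → Ω → Fin p → ℝ)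
    (t : ℤ) (k : ℕ) (ω : Ω) : Fin p → ℝ :=
  (coeffProd θ α η t k ω).mulVec (firstVec p (ε (t - (k : ℤ)) ω))

/-- The state vector `Φ_t = (X_t, X_{t-1}, …, X_{t-p+1})`. -/
def stateVec (p : ℕ) (X : ℤ → Ω → ℝ) (t : ℤ) (ω : Ω) : Fin p → ℝ :=
  fun i => X (t - (i.val : ℤ)) ω

/-- The `σ`-algebra `F_t` generated by the noises `(ε_s, η_s)`, `s ≤ t`. -/
@[reducible] def noiseSigma (ε : ℤ → Ω → ℝ) (η : ℤ → Ω → Fin p → ℝ) (t : ℤ) : MeasurableSpace Ω :=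
  ⨆ s ∈ Set.Iic t, MeasurableSpace.comap (fun ω => (ε s ω, η s ω)) inferInstance

variable [MeasurableSpace Ω]

/-- `(ε_t, η_{1,t}, …, η_{p,t})`, `t ∈ ℤ`, is an i.i.d. sequence of random vectors. -/
structure IsNoise (μ : Measure Ω) (ε : ℤ → Ω → ℝ) (η : ℤ → Ω → Fin p → ℝ) : Prop where
  measurable_eps : ∀ t, Measurable (ε t)
  measurable_eta : ∀ t, Measurable (η t)
  indep : iIndepFun (fun (t : ℤ) ω => (ε t ω, η t ω)) μ
  ident : ∀ t, IdentDistrib (fun ω => (ε t ω, η t ω)) (fun ω => (ε 0 ω, η 0 ω)) μ μ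

/-- `𝔼[ln Y] < 0` for a nonnegative random variable `Y`, with `ln 0 = -∞` and the value `-∞` of
the expectation allowed: `𝔼[ln⁺ Y] < 𝔼[ln⁻ Y]` in `[0, ∞]` (so that `𝔼[ln⁺ Y] < ∞`). -/
def LogMeanNeg (μ : Measure Ω) (Y : Ω → ℝ) : Prop :=
  ∫⁻ ω, (ENNReal.log (ENNReal.ofReal (Y ω))).toENNReal ∂μ
    < ∫⁻ ω, (-ENNReal.log (ENNReal.ofReal (Y ω))).toENNReal ∂μ

/-- `(X_t)` solves, almost surely for every `t ∈ ℤ`, the autoregression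
`X_t = ∑_{k=1}^p (θ_k + α_k η_{k,t-1} + η_{k,t}) X_{t-k} + ε_t`
(the index `k : Fin p` stands for `k + 1`). -/
def IsSolution (μ : Measure Ω) (θ α : Fin p → ℝ) (ε : ℤ → Ω → ℝ) (η : ℤ → Ω → Fin p → ℝ)
    (X : ℤ → Ω → ℝ) : Prop :=
  ∀ t : ℤ, ∀ᵐ ω ∂μ,
    X t ω = ∑ k : Fin p, (θ k + α k * η (t - 1) ω k + η t ω k) * X (t - ((k.val : ℤ) + 1)) ω
      + ε t ω

/-- For every `t ∈ ℤ`, almost surely, the series `∑_{k ≥ 1} A_t ⋯ A_{t-k+1} E_{t-k}` converges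
(absolutely) and `Φ_t = E_t + ∑_{k ≥ 1} A_t ⋯ A_{t-k+1} E_{t-k}`. -/
def HasCausalRepresentation (μ : Measure Ω) (θ α : Fin p → ℝ) (ε : ℤ → Ω → ℝ)
    (η : ℤ → Ω → Fin p → ℝ) (X : ℤ → Ω → ℝ) : Prop :=
  ∀ t : ℤ, ∀ᵐ ω ∂μ,
    Summable (fun k : ℕ => causalTerm θ α ε η t (k + 1) ω) ∧
      stateVec p X t ω
        = firstVec p (ε t ω) + ∑' k : ℕ, causalTerm θ α ε η t (k + 1) ω

/-- Strict stationarity: the finite-dimensional laws are invariant under time shifts. -/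
def IsStrictlyStationary (μ : Measure Ω) (X : ℤ → Ω → ℝ) : Prop :=
  ∀ (n : ℕ) (τ : Fin n → ℤ) (h : ℤ),
    μ.map (fun ω i => X (τ i + h) ω) = μ.map (fun ω i => X (τ i) ω)

/-- Ergodicity of a process: the time shift on path space `ℝ^ℤ` is ergodic for its law. -/
def IsErgodicProcess (μ : Measure Ω) (X : ℤ → Ω → ℝ) : Prop :=
  Ergodic (fun (x : ℤ → ℝ) (t : ℤ) => x (t + 1)) (μ.map (fun ω t => X t ω))

end Model

end RCAR

end

namespace RCAR

open Filter Topology Finset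

/-! ### Shifts of i.i.d. families -/

section Shift

variable {E : Type*} [MeasurableSpace E]

/-! Iterating `Φ_t = A_t Φ_{t-1} + E_t` leaves the partial sum of the causal series plus the
remainder `A_t ⋯ A_{t-n+1} Φ_{t-n}`, so everything rests on exponential decay of the products
(`exists_coeffProd_decay`). Submultiplicativity bounds the logarithm of the norm of a product by a
sum of terms `ln ‖A_{t-l}‖`, truncated below so that their mean is finite and still negative. These
terms are 1-dependent: even and odd indices give two i.i.d. families, and the ordinary strong law
suffices.

Existence: `E[ln⁺|ε_0|] < ∞` makes `ε_{t-k}` subexponential in `k`, so the series converges, and its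
first coordinate solves the equation.

Uniqueness: by tightness, with probability close to one `Φ_{t-n}` stays bounded for infinitely many
`n`; along these the remainder vanishes (`stateVec_eq_tsum_of_isTight`).

Stationarity and ergodicity: the solution is one measurable function of the shifted noise path,
hence a factor of the i.i.d. shift, which is ergodic. -/

theorem measurePreserving_shift_infinitePi (ν : Measure E) [IsProbabilityMeasure ν] (h : ℤ) :
    MeasurePreserving (fun (x : ℤ → E) t => x (t + h))
      (Measure.infinitePi fun _ : ℤ => ν) (Measure.infinitePi fun _ : ℤ => ν) := by
  have hm : Measurable (fun (x : ℤ → E) t => x (t + h)) := by fun_prop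
  refine ⟨hm, Measure.eq_infinitePi _ fun s A hA => ?_⟩
  rw [Measure.map_apply hm (.pi s.countable_toSet fun i _ => hA i)]
  have : (fun (x : ℤ → E) t => x (t + h)) ⁻¹' (Set.pi s A)
      = Set.pi (s.map (Equiv.addRight h).toEmbedding : Finset ℤ) (fun i => A (i - h)) := by
    ext x
    simp only [Set.mem_preimage, Set.mem_pi, Finset.mem_coe, Finset.mem_map_equiv]
    refine ⟨fun H i hi => by simpa [← sub_eq_add_neg] using H _ hi, fun H i hi => ?_⟩
    simpa using H (i + h) (by simpa using hi)
  rw [this, Measure.infinitePi_pi _ (fun i _ => hA _), Finset.prod_map]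
  simp

theorem exists_disjoint_image_add (I : Finset ℤ) :
    ∃ n : ℕ, Disjoint I (I.image fun i => i + (n : ℤ)) := by
  obtain ⟨B, hB⟩ : ∃ B : ℕ, ∀ i ∈ I, |i| ≤ B := by
    refine ⟨I.sup Int.natAbs, fun i hi => ?_⟩
    have := Finset.le_sup (f := Int.natAbs) hi
    rw [Int.abs_eq_natAbs]
    exact_mod_cast this
  refine ⟨2 * B + 1, Finset.disjoint_left.2 fun i hi hi' => ?_⟩
  obtain ⟨j, hj, rfl⟩ := Finset.mem_image.1 hi'
  have h1 := abs_le.1 (hB _ hi)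
  have h2 := abs_le.1 (hB _ hj)
  push_cast at h1
  omega

/-- Far enough apart, a cylinder and its translate depend on disjoint sets of coordinates, hence are
independent, and the shift preserves the measure. -/
theorem exists_measure_inter_shift_cylinder (ν : Measure E) [IsProbabilityMeasure ν]
    {C : Set (ℤ → E)} (hC : C ∈ measurableCylinders fun _ : ℤ => E) :
    ∃ n : ℕ, (Measure.infinitePi fun _ : ℤ => ν).real
      (C ∩ (fun (x : ℤ → E) t => x (t + (n : ℤ))) ⁻¹' C)
        = (Measure.infinitePi fun _ : ℤ => ν).real C ^ 2 := by
  classical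
  set P := Measure.infinitePi fun _ : ℤ => ν with hP
  obtain ⟨I, S, hS, rfl⟩ := (mem_measurableCylinders _).1 hC
  obtain ⟨n, hn⟩ := exists_disjoint_image_add I
  refine ⟨n, ?_⟩
  set J : Finset ℤ := I.image fun i => i + (n : ℤ)
  have hI : iIndepFun (fun (i : ℤ) (x : ℤ → E) => x i) P :=
    iIndepFun_infinitePi (X := fun _ e => e) (P := fun _ : ℤ => ν) fun _ => measurable_id
  have h1 := hI.indepFun_finset I J hn (fun i => measurable_pi_apply i)
  have hJ : ∀ i : I, (i : ℤ) + n ∈ J := fun i => Finset.mem_image_of_mem _ i.2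
  have hψ : Measurable (fun (y : J → E) (i : I) => y ⟨i + n, hJ i⟩) := by fun_prop
  have h2 := h1.comp measurable_id hψ
  have hs := measurePreserving_shift_infinitePi ν (n : ℤ)
  have h3 := h2.measure_inter_preimage_eq_mul S S hS hS
  have hcyl : MeasurableSet (cylinder (α := fun _ : ℤ => E) I S) :=
    MeasurableSet.cylinder (α := fun _ : ℤ => E) I hS
  have h4 : P ((fun (x : ℤ → E) t => x (t + (n : ℤ))) ⁻¹' cylinder I S) = P (cylinder I S) :=
    hs.measure_preimage hcyl.nullMeasurableSet
  have h5 : P (cylinder I S ∩ (fun (x : ℤ → E) t => x (t + (n : ℤ))) ⁻¹' cylinder I S)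
      = P (cylinder I S) * P (cylinder I S) := by
    exact h3.trans (congrArg _ h4)
  rw [measureReal_def, h5, ENNReal.toReal_mul, sq, measureReal_def]

/-- For an invariant `A` approximated by a cylinder `C`, `P(A) ≈ P(C ∩ T⁻¹C) = P(C)² ≈ P(A)²` with
`T` a suitable power of the shift. Hence `P(A) = P(A)²`. -/
theorem ergodic_shift_infinitePi (ν : Measure E) [IsProbabilityMeasure ν] :
    Ergodic (fun (x : ℤ → E) t => x (t + 1)) (Measure.infinitePi fun _ : ℤ => ν) := by
  set P := Measure.infinitePi fun _ : ℤ => ν with hP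
  have hs := measurePreserving_shift_infinitePi ν 1
  refine ⟨hs, ⟨fun A hA hinv => ?_⟩⟩
  have hinv' : ∀ n : ℕ, (fun (x : ℤ → E) t => x (t + (n : ℤ))) ⁻¹' A = A := by
    intro n
    induction n with
    | zero => simp
    | succ n ih =>
      conv_rhs => rw [← ih, ← hinv]
      ext x
      simp only [Set.mem_preimage]
      push_cast
      simp only [add_assoc, add_comm (1 : ℤ)]
  have hdense := Measure.MeasureDense.of_generateFrom_isSetAlgebra_finite P
    (𝒜 := measurableCylinders fun _ : ℤ => E)
    ⟨empty_mem_measurableCylinders _, fun s hs => compl_mem_measurableCylinders hs,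
      fun s t hs ht => union_mem_measurableCylinders hs ht⟩ generateFrom_measurableCylinders.symm
  have hsq : P.real A = P.real A ^ 2 := by
    refine eq_of_abs_sub_le_all fun δ hδ => ?_
    -- The intersection costs `2 · δ/4`, and replacing `P(C)²` by `P(A)²` another `2 · δ/4`.
    obtain ⟨C, hC, hAC⟩ := hdense.approx A hA (measure_ne_top _ _) (δ / 4) (by positivity)
    obtain ⟨n, hn⟩ := exists_measure_inter_shift_cylinder ν hC
    have hCm : MeasurableSet C := MeasurableSet.of_mem_measurableCylinders hC
    set T := fun (x : ℤ → E) t => x (t + (n : ℤ)) with hT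
    have hTp := measurePreserving_shift_infinitePi ν (n : ℤ)
    have hr : P.real (symmDiff A C) ≤ δ / 4 := by
      rw [measureReal_def]
      exact (ENNReal.toReal_le_of_le_ofReal (by positivity) hAC.le)
    have hrT : P.real (symmDiff A (T ⁻¹' C)) ≤ δ / 4 := by
      have : symmDiff A (T ⁻¹' C) = T ⁻¹' (symmDiff A C) := by
        rw [Set.preimage_symmDiff, hinv' n]
      rw [this, measureReal_def, hTp.measure_preimage (hA.symmDiff hCm).nullMeasurableSet]
      exact hr
    have h1 : |P.real A - P.real C| ≤ δ / 4 :=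
      (abs_measureReal_sub_le_measureReal_symmDiff hA.nullMeasurableSet
        hCm.nullMeasurableSet).trans hr
    have h2 : |P.real A - P.real (C ∩ T ⁻¹' C)| ≤ δ / 4 + δ / 4 := by
      refine (abs_measureReal_sub_le_measureReal_symmDiff hA.nullMeasurableSet
        (hCm.inter (hTp.measurable hCm)).nullMeasurableSet).trans ?_
      refine (measureReal_mono (s₂ := symmDiff A C ∪ symmDiff A (T ⁻¹' C)) ?_).trans
        ((measureReal_union_le _ _).trans (add_le_add hr hrT))
      intro x
      simp only [Set.mem_symmDiff, Set.mem_inter_iff, Set.mem_union]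
      tauto
    rw [hn] at h2
    have hA1 : P.real A ≤ 1 := measureReal_le_one
    have hC1 : P.real C ≤ 1 := measureReal_le_one
    have hA0 : 0 ≤ P.real A := measureReal_nonneg
    have hC0 : 0 ≤ P.real C := measureReal_nonneg
    rw [abs_le] at h1 h2 ⊢
    constructor <;> nlinarith
  have h01 : P.real A = 0 ∨ P.real A = 1 := by
    rcases eq_or_ne (P.real A) 0 with h | h
    · exact Or.inl h
    · refine Or.inr (mul_left_cancel₀ h ?_)
      rw [mul_one, ← sq, ← hsq]
  rw [eventuallyConst_set']
  rcases h01 with h | h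
  · left
    rw [measureReal_eq_zero_iff] at h
    exact ae_eq_empty.2 h
  · right
    rw [ae_eq_univ, prob_compl_eq_zero_iff hA]
    rw [measureReal_def] at h
    exact (ENNReal.toReal_eq_one_iff _).1 h

end Shift

section Noise

variable {Ω E : Type*} [MeasurableSpace Ω] [MeasurableSpace E] {μ : Measure Ω}
  {ζ : ℤ → Ω → E}

theorem map_shift_eq_infinitePi (hm : ∀ t, Measurable (ζ t)) (hi : iIndepFun ζ μ)
    (hd : ∀ t, IdentDistrib (ζ t) (ζ 0) μ μ) (h : ℤ) :
    μ.map (fun ω s => ζ (s + h) ω) = Measure.infinitePi fun _ : ℤ => μ.map (ζ 0) := by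
  have h1 : iIndepFun (fun s => ζ (s + h)) μ := hi.precomp (add_left_injective h)
  rw [h1.map_fun_eq_infinitePi_map fun s => hm _]
  congr 1
  funext s
  exact (hd _).map_eq

/-- A single term divided by `n` is `S (n + 1) / n - S n / n`, and both quotients tend to the mean
by the strong law. -/
theorem eventually_le_mul_nat (hi : iIndepFun ζ μ) (hd : ∀ t, IdentDistrib (ζ t) (ζ 0) μ μ)
    {f : E → ℝ} (hf : Measurable f)
    (hint : Integrable (fun ω => f (ζ 0 ω)) μ) {δ : ℝ} (hδ : 0 < δ) (t : ℤ) :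
    ∀ᵐ ω ∂μ, ∀ᶠ n : ℕ in atTop, f (ζ (t - (n : ℤ)) ω) ≤ δ * n := by
  have hp : ∀ s : ℤ, IdentDistrib (fun ω => f (ζ s ω)) (fun ω => f (ζ 0 ω)) μ μ :=
    fun s => (hd s).comp hf
  have h := strong_law_ae_real (fun (j : ℕ) ω => f (ζ (t - (j : ℤ)) ω))
    ((hp _).integrable_iff.2 hint)
    (fun i j hij => (hi.indepFun (by omega)).comp hf hf)
    (fun j => (hp _).trans (hp _).symm)
  filter_upwards [h] with ω hω
  set m := ∫ ω, f (ζ (t - ((0 : ℕ) : ℤ)) ω) ∂μ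
  set S : ℕ → ℝ := fun n => ∑ j ∈ range n, f (ζ (t - (j : ℤ)) ω) with hS
  have h1 : Tendsto (fun n : ℕ => S (n + 1) / ((n + 1 : ℕ) : ℝ)) atTop (𝓝 m) :=
    hω.comp (tendsto_add_atTop_nat 1)
  have h2 : Tendsto (fun n : ℕ => ((n : ℝ) + 1) / n) atTop (𝓝 1) := by
    have : Tendsto (fun n : ℕ => 1 + 1 / (n : ℝ)) atTop (𝓝 (1 + 0)) :=
      tendsto_const_nhds.add tendsto_one_div_atTop_nhds_zero_nat
    rw [add_zero] at this
    refine this.congr' ?_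
    filter_upwards [eventually_gt_atTop 0] with n hn
    have : (n : ℝ) ≠ 0 := by positivity
    field_simp
  have h3 := (h1.mul h2).sub hω
  rw [mul_one, sub_self] at h3
  filter_upwards [h3.eventually_lt_const hδ, eventually_gt_atTop 0] with n hn hpos
  have hn0 : (0 : ℝ) < n := by exact_mod_cast hpos
  have e : S (n + 1) / ((n + 1 : ℕ) : ℝ) * (((n : ℝ) + 1) / n)
      - (∑ i ∈ range n, f (ζ (t - (i : ℤ)) ω)) / n = f (ζ (t - (n : ℤ)) ω) / n := by
    simp only [hS, sum_range_succ]
    push_cast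
    field_simp
    ring
  rw [e] at hn
  exact ((div_lt_iff₀ hn0).1 hn).le

theorem identDistrib_shift (hm : ∀ t, Measurable (ζ t)) (hi : iIndepFun ζ μ)
    (hd : ∀ t, IdentDistrib (ζ t) (ζ 0) μ μ) (h h' : ℤ) :
    IdentDistrib (fun ω s => ζ (s + h) ω) (fun ω s => ζ (s + h') ω) μ μ :=
  ⟨(measurable_pi_lambda _ fun s => hm _).aemeasurable,
    (measurable_pi_lambda _ fun s => hm _).aemeasurable,
    by rw [map_shift_eq_infinitePi hm hi hd, map_shift_eq_infinitePi hm hi hd]⟩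

theorem identDistrib_pair (hm : ∀ t, Measurable (ζ t)) (hi : iIndepFun ζ μ)
    (hd : ∀ t, IdentDistrib (ζ t) (ζ 0) μ μ) (s t : ℤ) :
    IdentDistrib (fun ω => (ζ (s - 1) ω, ζ s ω)) (fun ω => (ζ (t - 1) ω, ζ t ω)) μ μ := by
  have h := (identDistrib_shift hm hi hd s t).comp
    (u := fun x : ℤ → E => (x (-1), x 0)) (by fun_prop)
  simpa [Function.comp_def, neg_add_eq_sub] using h

/-- A process that is a.s. the factor `G` of the shifts of an i.i.d. family is stationary. -/
theorem isStrictlyStationary_of_ae_eq_factor (hm : ∀ t, Measurable (ζ t)) (hi : iIndepFun ζ μ)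
    (hd : ∀ t, IdentDistrib (ζ t) (ζ 0) μ μ)
    {G : (ℤ → E) → ℝ} (hG : Measurable G) {X : ℤ → Ω → ℝ} (hX : ∀ t, X t =ᵐ[μ] fun ω => G fun s => ζ (s + t) ω) :
    IsStrictlyStationary μ X := by
  intro n τ h
  -- The right-hand side does not involve `h`, so comparison with `h = 0` gives stationarity.
  have key : ∀ h : ℤ, μ.map (fun ω i => X (τ i + h) ω)
      = (Measure.infinitePi fun _ : ℤ => μ.map (ζ 0)).map
        (fun x i => G fun s => x (s + τ i)) := by
    intro h
    rw [← map_shift_eq_infinitePi hm hi hd h, Measure.map_map (by fun_prop)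
      (measurable_pi_lambda _ fun s => hm _)]
    refine Measure.map_congr ?_
    filter_upwards [ae_all_iff.2 fun i => hX (τ i + h)] with ω hω
    funext i
    simp [hω i, add_assoc]
  rw [key h, ← key 0]
  simp

/-- A process that is a.s. the factor `G` of the shifts of an i.i.d. family is ergodic. -/
theorem isErgodicProcess_of_ae_eq_factor [IsProbabilityMeasure μ]
    (hm : ∀ t, Measurable (ζ t)) (hi : iIndepFun ζ μ) (hd : ∀ t, IdentDistrib (ζ t) (ζ 0) μ μ)
    {G : (ℤ → E) → ℝ} (hG : Measurable G) {X : ℤ → Ω → ℝ} (hX : ∀ t, X t =ᵐ[μ] fun ω => G fun s => ζ (s + t) ω) :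
    IsErgodicProcess μ X := by
  have : IsProbabilityMeasure (μ.map (ζ 0)) :=
    Measure.isProbabilityMeasure_map (hm 0).aemeasurable
  have hg : Measurable (fun (x : ℤ → E) (t : ℤ) => G fun s => x (s + t)) := by fun_prop
  have hmap : μ.map (fun ω t => X t ω) = (Measure.infinitePi fun _ : ℤ => μ.map (ζ 0)).map
      (fun x t => G fun s => x (s + t)) := by
    rw [← map_shift_eq_infinitePi hm hi hd 0, Measure.map_map hg
      (measurable_pi_lambda _ fun s => hm _)]
    refine Measure.map_congr ?_
    filter_upwards [ae_all_iff.2 hX] with ω hω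
    funext t
    simp [hω t]
  unfold IsErgodicProcess
  rw [hmap]
  -- The factor map commutes with the two shifts, so ergodicity passes to the image law.
  refine MeasurePreserving.ergodic_of_ergodic_semiconj (f := fun (x : ℤ → E) t => x (t + 1))
    ⟨hg, rfl⟩ (ergodic_shift_infinitePi _) (by fun_prop) fun x => ?_
  funext t
  simp only [add_assoc]

/-- With stride 2 the pairs occupy disjoint pairs of indices, hence are independent. -/
theorem tendsto_average_pair (hm : ∀ t, Measurable (ζ t)) (hi : iIndepFun ζ μ)
    (hd : ∀ t, IdentDistrib (ζ t) (ζ 0) μ μ) {f : E × E → ℝ} (hf : Measurable f)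
    (hint : Integrable (fun ω => f (ζ 0 ω, ζ 1 ω)) μ) (t : ℤ) :
    ∀ᵐ ω ∂μ, Tendsto (fun n : ℕ =>
      (∑ j ∈ range n, f (ζ (t - 2 * (j : ℤ) - 1) ω, ζ (t - 2 * (j : ℤ)) ω)) / n) atTop
        (𝓝 (∫ ω, f (ζ 0 ω, ζ 1 ω) ∂μ)) := by
  have hp : ∀ s : ℤ, IdentDistrib (fun ω => f (ζ (s - 1) ω, ζ s ω))
      (fun ω => f (ζ 0 ω, ζ 1 ω)) μ μ := fun s => by
    simpa [Function.comp_def] using (identDistrib_pair hm hi hd s 1).comp hf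
  have h := strong_law_ae_real
    (fun (j : ℕ) ω => f (ζ (t - 2 * (j : ℤ) - 1) ω, ζ (t - 2 * (j : ℤ)) ω))
    ((hp _).integrable_iff.2 hint)
    (fun i j hij => (hi.indepFun_prodMk_prodMk hm _ _ _ _ (by omega) (by omega) (by omega)
      (by omega)).comp hf hf)
    (fun j => (hp _).trans (hp _).symm)
  rwa [(hp _).integral_eq] at h

/-- The averages of the `1`-dependent sequence `f (ζ_{t-i-1}, ζ_{t-i})` are eventually below any
number larger than the mean. -/
theorem eventually_sum_pair_le (hm : ∀ t, Measurable (ζ t)) (hi : iIndepFun ζ μ)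
    (hd : ∀ t, IdentDistrib (ζ t) (ζ 0) μ μ) {f : E × E → ℝ} (hf : Measurable f)
    (hint : Integrable (fun ω => f (ζ 0 ω, ζ 1 ω)) μ) {c : ℝ}
    (hc : ∫ ω, f (ζ 0 ω, ζ 1 ω) ∂μ < c) (t : ℤ) :
    ∀ᵐ ω ∂μ, ∀ᶠ n : ℕ in atTop,
      ∑ j ∈ range n, f (ζ (t - (j : ℤ) - 1) ω, ζ (t - (j : ℤ)) ω) ≤ c * n := by
  -- Starting from `t` gives the terms of even index, starting from `t - 1` those of odd index.
  filter_upwards [tendsto_average_pair hm hi hd hf hint t,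
    tendsto_average_pair hm hi hd hf hint (t - 1)] with ω h0 h1
  set F : ℕ → ℝ := fun j => f (ζ (t - (j : ℤ) - 1) ω, ζ (t - (j : ℤ)) ω) with hF
  have e0 : ∀ j : ℕ, f (ζ (t - 2 * (j : ℤ) - 1) ω, ζ (t - 2 * (j : ℤ)) ω) = F (2 * j) := by
    intro j; simp [hF]
  have e1 : ∀ j : ℕ, f (ζ (t - 1 - 2 * (j : ℤ) - 1) ω, ζ (t - 1 - 2 * (j : ℤ)) ω)
      = F (2 * j + 1) := by
    intro j
    have : t - 1 - 2 * (j : ℤ) = t - ((2 * j + 1 : ℕ) : ℤ) := by push_cast; ring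
    simp only [hF, this]
  simp only [e0] at h0
  simp only [e1] at h1
  have hsplit : ∀ n : ℕ, ∑ j ∈ range n, F j
      = ∑ j ∈ range ((n + 1) / 2), F (2 * j) + ∑ j ∈ range (n / 2), F (2 * j + 1) := by
    intro n
    induction n with
    | zero => simp
    | succ n ih =>
      rw [sum_range_succ, ih]
      rcases Nat.even_or_odd' n with ⟨k, rfl | rfl⟩
      · rw [show (2 * k + 1 + 1) / 2 = k + 1 by omega, show (2 * k + 1) / 2 = k by omega,
          show 2 * k / 2 = k by omega, sum_range_succ]
        ring
      · rw [show (2 * k + 1 + 1 + 1) / 2 = k + 1 by omega,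
          show (2 * k + 1 + 1) / 2 = k + 1 by omega, show (2 * k + 1) / 2 = k by omega,
          sum_range_succ (fun j => F (2 * j + 1))]
        ring
  have bound : ∀ {u : ℕ → ℝ} {m : ℝ}, Tendsto (fun n : ℕ => u n / n) atTop (𝓝 m) → m < c →
      ∀ᶠ n : ℕ in atTop, u n ≤ c * n := by
    intro u m hu hmc
    filter_upwards [hu.eventually_lt_const hmc, eventually_gt_atTop 0] with n hn hpos
    have : (0 : ℝ) < n := by exact_mod_cast hpos
    exact ((div_lt_iff₀ this).1 hn).le
  have t0 : Tendsto (fun n : ℕ => (n + 1) / 2) atTop atTop :=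
    tendsto_atTop_atTop.2 fun b => ⟨2 * b, fun a ha => by omega⟩
  have t1 : Tendsto (fun n : ℕ => n / 2) atTop atTop :=
    tendsto_atTop_atTop.2 fun b => ⟨2 * b, fun a ha => by omega⟩
  filter_upwards [t0.eventually (bound h0 hc), t1.eventually (bound h1 hc)] with n hn0 hn1
  rw [hsplit n]
  have : ((((n + 1) / 2 : ℕ) : ℝ) + ((n / 2 : ℕ) : ℝ)) = n := by
    rw [← Nat.cast_add]; congr 1; omega
  calc _ ≤ c * (((n + 1) / 2 : ℕ) : ℝ) + c * ((n / 2 : ℕ) : ℝ) := add_le_add hn0 hn1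
    _ = c * n := by rw [← mul_add, this]

end Noise

/-! ### Logarithmic moments -/

section Log

/-- Since `exp (-M) ≤ 1`, truncation there leaves `ln⁺` unchanged; the companion lemma below shows
that it caps `ln⁻` at `M`. -/
theorem ofReal_log_max_exp {y : ℝ} (hy : 0 ≤ y) (M : ℕ) :
    ENNReal.ofReal (Real.log (max y (Real.exp (-M))))
      = (ENNReal.log (ENNReal.ofReal y)).toENNReal := by
  rcases hy.eq_or_lt with rfl | hy
  · simp [max_eq_right (Real.exp_pos _).le]
  · rw [ENNReal.log_ofReal_of_pos hy, EReal.toENNReal_of_ne_top (by simp), EReal.toReal_coe]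
    rcases le_total (Real.exp (-M)) y with h | h
    · rw [max_eq_left h]
    · rw [max_eq_right h, Real.log_exp, ENNReal.ofReal_of_nonpos (by simp),
        ENNReal.ofReal_of_nonpos]
      refine Real.log_nonpos hy.le (h.trans ?_)
      simp

theorem ofReal_neg_log_max_exp {y : ℝ} (hy : 0 ≤ y) (M : ℕ) :
    ENNReal.ofReal (-Real.log (max y (Real.exp (-M))))
      = min (-ENNReal.log (ENNReal.ofReal y)).toENNReal M := by
  rcases hy.eq_or_lt with rfl | hy
  · simp [max_eq_right (Real.exp_pos _).le]
  · rw [ENNReal.log_ofReal_of_pos hy, ← EReal.coe_neg, EReal.toENNReal_of_ne_top (by simp),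
      EReal.toReal_coe]
    rw [← ENNReal.ofReal_natCast, ← ENNReal.ofReal_min]
    congr 1
    rcases le_total (Real.exp (-M)) y with h | h
    · rw [max_eq_left h, min_eq_left]
      have := (Real.le_log_iff_exp_le hy).2 h
      linarith
    · rw [max_eq_right h, Real.log_exp, min_eq_right (by
        have := (Real.log_le_iff_le_exp hy).2 h
        linarith)]
      simp

/-- A negative (possibly infinite) logarithmic mean stays negative after truncating `ln Y` below
at a suitable level. -/
theorem LogMeanNeg.exists_truncation {Ω : Type*} [MeasurableSpace Ω] {μ : Measure Ω}
    [IsFiniteMeasure μ] {Y : Ω → ℝ} (hm : Measurable Y) (h0 : ∀ ω, 0 ≤ Y ω)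
    (h : LogMeanNeg μ Y) :
    ∃ M : ℕ, Integrable (fun ω => Real.log (max (Y ω) (Real.exp (-M)))) μ ∧
      ∫ ω, Real.log (max (Y ω) (Real.exp (-M))) ∂μ < 0 := by
  have hN : Measurable fun ω => (-ENNReal.log (ENNReal.ofReal (Y ω))).toENNReal := by
    have := hm.ennreal_ofReal.ennreal_log
    exact (continuous_neg.measurable.comp this).ereal_toENNReal
  have hsup : ∀ a : ℝ≥0∞, a = ⨆ M : ℕ, min a (M : ℝ≥0∞) := by
    intro a
    rw [← inf_iSup_eq, ENNReal.iSup_natCast, inf_top_eq]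
  have hmono : Monotone fun (M : ℕ) ω =>
      min (-ENNReal.log (ENNReal.ofReal (Y ω))).toENNReal (M : ℝ≥0∞) := by
    intro M M' hM ω
    exact min_le_min le_rfl (by exact_mod_cast hM)
  unfold LogMeanNeg at h
  -- Monotone convergence: at some level `M` the capped negative part already has a larger integral
  -- than the positive part.
  have e : ∫⁻ ω, (-ENNReal.log (ENNReal.ofReal (Y ω))).toENNReal ∂μ
      = ⨆ M : ℕ, ∫⁻ ω, min (-ENNReal.log (ENNReal.ofReal (Y ω))).toENNReal (M : ℝ≥0∞) ∂μ := by
    rw [← lintegral_iSup (fun M => hN.min measurable_const) hmono]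
    exact lintegral_congr fun ω => hsup _
  rw [e, lt_iSup_iff] at h
  obtain ⟨M, hM⟩ := h
  have hpos := fun ω => ofReal_log_max_exp (h0 ω) M
  have hneg := fun ω => ofReal_neg_log_max_exp (h0 ω) M
  simp only [← hpos, ← hneg] at hM
  have hnegfin : ∫⁻ ω, ENNReal.ofReal (-Real.log (max (Y ω) (Real.exp (-M)))) ∂μ ≠ ⊤ := by
    refine ne_top_of_le_ne_top (b := ∫⁻ _, (M : ℝ≥0∞) ∂μ) ?_ (lintegral_mono fun ω => ?_)
    · simp [ENNReal.mul_eq_top]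
    · rw [hneg]; exact min_le_right _ _
  have hmeas : Measurable fun ω => Real.log (max (Y ω) (Real.exp (-M))) :=
    (hm.max measurable_const).log
  have hint : Integrable (fun ω => Real.log (max (Y ω) (Real.exp (-M)))) μ := by
    refine ⟨hmeas.aestronglyMeasurable, ?_⟩
    refine lt_of_le_of_lt (lintegral_mono (g := fun ω =>
      ENNReal.ofReal (Real.log (max (Y ω) (Real.exp (-M)))) +
      ENNReal.ofReal (-Real.log (max (Y ω) (Real.exp (-M))))) fun ω => ?_) ?_
    · rw [← ofReal_norm, Real.norm_eq_abs]
      set a := Real.log (max (Y ω) (Real.exp (-M)))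
      rcases le_total 0 a with ha | ha
      · rw [abs_of_nonneg ha]; exact le_self_add
      · rw [abs_of_nonpos ha]; exact le_add_self
    · rw [lintegral_add_left hmeas.ennreal_ofReal]
      exact ENNReal.add_lt_top.2 ⟨hM.trans_le le_top, hnegfin.lt_top⟩
  refine ⟨M, hint, ?_⟩
  rw [integral_eq_lintegral_pos_part_sub_lintegral_neg_part hint, sub_neg]
  exact (ENNReal.toReal_lt_toReal hM.ne_top hnegfin).2 hM

end Log

/-! ### Submultiplicative matrix norms -/

section Norm

variable {n : Type*} [Fintype n] [DecidableEq n]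

/-- From `E_ii B E_ji = B_ij E_ii`, submultiplicativity bounds the entry after division by the
positive norm of `E_ii`. -/
theorem abs_entry_le (nrm : AlgebraNorm ℝ (Matrix n n ℝ)) (B : Matrix n n ℝ) (i j : n) :
    |B i j| ≤ nrm (Matrix.single j i 1) * nrm B := by
  have h : Matrix.single i i (1 : ℝ) * (B * Matrix.single j i 1) = B i j • Matrix.single i i 1 := by
    rw [← Matrix.mul_assoc, Matrix.single_mul_mul_single, Matrix.smul_single]
    simp
  have hpos : 0 < nrm (Matrix.single i i 1) := by
    refine lt_of_le_of_ne (apply_nonneg _ _) fun h0 => ?_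
    have := congrFun (congrFun (eq_zero_of_map_eq_zero nrm h0.symm) i) i
    simp at this
  have h1 : nrm (B i j • Matrix.single i i 1) = |B i j| * nrm (Matrix.single i i 1) := by
    rw [map_smul_eq_mul, Real.norm_eq_abs]
  have h2 : |B i j| * nrm (Matrix.single i i 1)
      ≤ (nrm (Matrix.single j i 1) * nrm B) * nrm (Matrix.single i i 1) := by
    rw [← h1, ← h]
    calc _ ≤ nrm (Matrix.single i i 1) * nrm (B * Matrix.single j i 1) := map_mul_le_mul _ _ _
      _ ≤ nrm (Matrix.single i i 1) * (nrm B * nrm (Matrix.single j i 1)) :=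
        mul_le_mul_of_nonneg_left (map_mul_le_mul _ _ _) hpos.le
      _ = _ := by ring
  exact le_of_mul_le_mul_right h2 hpos

/-- Needed for the measurability of `‖A_t‖`. Expansion in matrix units gives continuity at `0`, and
the reverse triangle inequality transports it elsewhere. -/
theorem continuous_algebraNorm (nrm : AlgebraNorm ℝ (Matrix n n ℝ)) :
    Continuous (nrm : Matrix n n ℝ → ℝ) := by
  have hle : ∀ B : Matrix n n ℝ, nrm B ≤ ∑ i, ∑ j, |B i j| * nrm (Matrix.single i j 1) := by
    intro B
    conv_lhs => rw [Matrix.matrix_eq_sum_single B]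
    refine (Finset.le_sum_of_subadditive nrm (map_zero nrm).le (map_add_le_add nrm) _ _).trans
      (sum_le_sum fun i _ => ?_)
    refine (Finset.le_sum_of_subadditive nrm (map_zero nrm).le (map_add_le_add nrm) _ _).trans
      (sum_le_sum fun j _ => ?_)
    rw [← Real.norm_eq_abs, ← map_smul_eq_mul nrm, Matrix.smul_single, smul_eq_mul, mul_one]
  have h0 : ContinuousAt (nrm : Matrix n n ℝ → ℝ) 0 := by
    have hc : Continuous fun B : Matrix n n ℝ =>
        ∑ i, ∑ j, |B i j| * nrm (Matrix.single i j 1) := by fun_prop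
    have ht := hc.tendsto 0
    simp only [Matrix.zero_apply, abs_zero, zero_mul, sum_const_zero] at ht
    rw [ContinuousAt, map_zero]
    exact squeeze_zero (fun B => apply_nonneg nrm B) hle ht
  refine continuous_iff_continuousAt.2 fun B => ?_
  have h1 : Tendsto (fun C : Matrix n n ℝ => nrm (C - B)) (𝓝 B) (𝓝 0) := by
    have : Tendsto (fun C : Matrix n n ℝ => C - B) (𝓝 B) (𝓝 0) :=
      (continuous_id.sub continuous_const).tendsto' _ _ (sub_self B)
    simpa [ContinuousAt, Function.comp_def] using h0.tendsto.comp this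
  rw [ContinuousAt, tendsto_iff_norm_sub_tendsto_zero]
  exact squeeze_zero (fun _ => norm_nonneg _) (fun C => abs_sub_map_le_sub nrm C B) h1

/-- A majorant `exp (g k)` replaces `nrm (f k)`, which may vanish. The factor `nrm 1` accounts for
the empty product, as `nrm 1 = 1` is not assumed. -/
theorem algebraNorm_list_prod_le (nrm : AlgebraNorm ℝ (Matrix n n ℝ)) (f : ℕ → Matrix n n ℝ)
    {g : ℕ → ℝ} (hg : ∀ k, nrm (f k) ≤ Real.exp (g k)) (k : ℕ) :
    nrm ((List.range k).map f).prod ≤ nrm 1 * Real.exp (∑ i ∈ range k, g i) := by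
  induction k with
  | zero => simp
  | succ k ih =>
    rw [List.range_succ, List.map_append, List.prod_append, sum_range_succ, Real.exp_add,
      ← mul_assoc]
    refine (map_mul_le_mul nrm _ _).trans (mul_le_mul ih ?_ (apply_nonneg _ _) ?_)
    · simpa using hg k
    · exact mul_nonneg (apply_nonneg _ _) (Real.exp_pos _).le

end Norm

/-! ### Algebra of the coefficient products -/

section Algebra

variable {Ω : Type*} {p : ℕ} (θ α : Fin p → ℝ) (ε : ℤ → Ω → ℝ) (η : ℤ → Ω → Fin p → ℝ)
  (t : ℤ) (ω : Ω)

theorem coeffMatrix_apply (i j : Fin p) :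
    coeffMatrix θ α η t ω i j = if i.val = 0 then θ j + α j * η (t - 1) ω j + η t ω j
      else if i.val = j.val + 1 then 1 else 0 := by
  simp only [coeffMatrix, companion, rowMatrix, Matrix.add_apply, Matrix.mul_diagonal,
    Matrix.of_apply]
  split_ifs <;> ring

theorem coeffMatrix_mulVec_of_val_eq_zero (v : Fin p → ℝ) {i : Fin p} (hi : i.val = 0) :
    (coeffMatrix θ α η t ω).mulVec v i
      = ∑ k, (θ k + α k * η (t - 1) ω k + η t ω k) * v k := by
  simp [Matrix.mulVec, dotProduct, coeffMatrix_apply, hi]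

theorem coeffMatrix_mulVec_of_val_eq_succ (v : Fin p → ℝ) {i j : Fin p}
    (hij : i.val = j.val + 1) : (coeffMatrix θ α η t ω).mulVec v i = v j := by
  rw [Matrix.mulVec, dotProduct, Finset.sum_eq_single j]
  · simp [coeffMatrix_apply, hij]
  · intro b _ hb
    have : i.val ≠ b.val + 1 := fun h => hb (Fin.ext (by omega))
    rw [coeffMatrix_apply, if_neg (by omega), if_neg this, zero_mul]
  · simp

/-- In `coeffProd` the index is elaborated as an integer and the range is coerced through a monadic
bind; here the index is natural. -/
theorem coeffProd_eq_prod_map (k : ℕ) : coeffProd θ α η t k ω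
    = ((List.range k).map fun l : ℕ => coeffMatrix θ α η (t - (l : ℤ)) ω).prod := by
  have h : (do let a ← List.range k; pure (a : ℤ)) = (List.range k).map Nat.cast :=
    (List.map_eq_flatMap (f := (Nat.cast : ℕ → ℤ)) (l := List.range k)).symm
  rw [coeffProd, h, List.map_map]
  rfl

theorem coeffProd_succ (k : ℕ) : coeffProd θ α η t (k + 1) ω
    = coeffMatrix θ α η t ω * coeffProd θ α η (t - 1) k ω := by
  rw [coeffProd_eq_prod_map, List.range_succ_eq_map, List.map_cons, List.prod_cons, List.map_map,
    coeffProd_eq_prod_map, Nat.cast_zero, sub_zero]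
  congr 3
  funext l
  rw [Function.comp_apply, Nat.cast_succ, sub_add_eq_sub_sub_swap]

theorem causalTerm_zero : causalTerm θ α ε η t 0 ω = firstVec p (ε t ω) := by
  simp [causalTerm, coeffProd]

theorem causalTerm_succ (k : ℕ) : causalTerm θ α ε η t (k + 1) ω
    = (coeffMatrix θ α η t ω).mulVec (causalTerm θ α ε η (t - 1) k ω) := by
  rw [causalTerm, coeffProd_succ, ← Matrix.mulVec_mulVec, causalTerm]
  congr 4
  push_cast
  ring

theorem causalTerm_apply {i₀ : Fin p} (h₀ : i₀.val = 0) (k : ℕ) (i : Fin p) :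
    causalTerm θ α ε η t k ω i = coeffProd θ α η t k ω i i₀ * ε (t - (k : ℤ)) ω := by
  rw [causalTerm, Matrix.mulVec, dotProduct, Finset.sum_eq_single i₀]
  · simp [firstVec, h₀]
  · intro b _ hb
    have : b.val ≠ 0 := fun h => hb (Fin.ext (by omega))
    simp [firstVec, this]
  · simp

/-- Iterating `Φ_t = A_t Φ_{t-1} + E_t`. -/
theorem eq_sum_causalTerm_add {Φ : ℤ → Fin p → ℝ}
    (hΦ : ∀ t, Φ t = (coeffMatrix θ α η t ω).mulVec (Φ (t - 1)) + firstVec p (ε t ω)) (n : ℕ) :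
    Φ t = ∑ k ∈ range n, causalTerm θ α ε η t k ω
      + (coeffProd θ α η t n ω).mulVec (Φ (t - n)) := by
  induction n generalizing t with
  | zero => simp [coeffProd]
  | succ n ih =>
    rw [hΦ t, ih (t - 1), Matrix.mulVec_add, Matrix.mulVec_mulVec, ← coeffProd_succ,
      sum_range_succ', causalTerm_zero, Matrix.mulVec_sum]
    simp only [causalTerm_succ]
    rw [show t - 1 - (n : ℤ) = t - ((n + 1 : ℕ) : ℤ) by push_cast; ring]
    abel

theorem tsum_causalTerm_eq (h0 : Summable fun k => causalTerm θ α ε η t k ω) :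
    ∑' k, causalTerm θ α ε η t k ω
      = firstVec p (ε t ω) + ∑' k, causalTerm θ α ε η t (k + 1) ω := by
  rw [h0.tsum_eq_zero_add, causalTerm_zero]

theorem tsum_causalTerm_succ (h1 : Summable fun k => causalTerm θ α ε η (t - 1) k ω) :
    ∑' k, causalTerm θ α ε η t (k + 1) ω
      = (coeffMatrix θ α η t ω).mulVec (∑' k, causalTerm θ α ε η (t - 1) k ω) := by
  simp only [causalTerm_succ]
  exact (h1.hasSum.map (Matrix.mulVecLin (coeffMatrix θ α η t ω))
    (Continuous.matrix_mulVec continuous_const continuous_id)).tsum_eq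

/-- The first coordinate of the causal series, as a limit of its partial sums. -/
noncomputable def causalSolution (i₀ : Fin p) (t : ℤ) (ω : Ω) : ℝ :=
  limUnder atTop fun n : ℕ => ∑ k ∈ range n, causalTerm θ α ε η t k ω i₀

variable {θ α ε η t ω} in
theorem causalSolution_eq_tsum {i₀ : Fin p} (h : Summable fun k => causalTerm θ α ε η t k ω) :
    causalSolution θ α ε η i₀ t ω = (∑' k, causalTerm θ α ε η t k ω) i₀ := by
  have := (Pi.hasSum.1 h.hasSum i₀).tendsto_sum_nat
  exact this.limUnder_eq

/-- The causal series satisfies the shift structure of a state vector. -/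
theorem tsum_causalTerm_apply {i₀ : Fin p} (h₀ : i₀.val = 0)
    (h : ∀ t, Summable fun k => causalTerm θ α ε η t k ω) (i : Fin p) :
    (∑' k, causalTerm θ α ε η t k ω) i = causalSolution θ α ε η i₀ (t - (i.val : ℤ)) ω := by
  obtain ⟨n, hn⟩ := i
  induction n generalizing t with
  | zero =>
    rw [causalSolution_eq_tsum (h _)]
    simp only [Nat.cast_zero, sub_zero]
    exact congrArg _ (Fin.ext h₀.symm)
  -- The subdiagonal of `A_t` moves coordinate `n` at time `t - 1` to coordinate `n + 1` at time
  -- `t`.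
  | succ n ih =>
    rw [tsum_causalTerm_eq _ _ _ _ _ _ (h t), tsum_causalTerm_succ _ _ _ _ _ _ (h (t - 1)),
      Pi.add_apply, coeffMatrix_mulVec_of_val_eq_succ (j := ⟨n, by omega⟩) _ _ _ _ _ _ rfl, ih]
    simp only [firstVec, Nat.add_eq_zero_iff, one_ne_zero, and_false, if_false, zero_add]
    congr 1
    push_cast
    ring

/-- Evaluating the canonical noise on a shifted path exhibits the solution at every time as the same
function of the shifted noise. -/
theorem causalTerm_path (u : ℤ) (k : ℕ) :
    causalTerm θ α (fun s (x : ℤ → ℝ × (Fin p → ℝ)) => (x s).1) (fun s x => (x s).2) u k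
      (fun s => (ε (s + t) ω, η (s + t) ω)) = causalTerm θ α ε η (u + t) k ω := by
  induction k generalizing u with
  | zero => simp [causalTerm_zero]
  | succ k ih =>
    rw [causalTerm_succ, causalTerm_succ, ih]
    simp only [coeffMatrix, sub_add_eq_add_sub]

theorem causalSolution_path (i₀ : Fin p) :
    causalSolution θ α ε η i₀ t ω
      = causalSolution θ α (fun s (x : ℤ → ℝ × (Fin p → ℝ)) => (x s).1) (fun s x => (x s).2) i₀ 0
        (fun s => (ε (s + t) ω, η (s + t) ω)) := by
  simp only [causalSolution, causalTerm_path, zero_add]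

end Algebra

/-! ### Measurability -/

section Measurability

variable {Ω : Type*} {m : MeasurableSpace Ω} {p : ℕ} (θ α : Fin p → ℝ) {ε : ℤ → Ω → ℝ}
  {η : ℤ → Ω → Fin p → ℝ} {t : ℤ}

theorem measurable_coeffMatrix_apply (hη : ∀ s ≤ t, Measurable (η s)) (i j : Fin p) :
    Measurable fun ω => coeffMatrix θ α η t ω i j := by
  have h0 := (measurable_pi_apply j).comp (hη t le_rfl)
  have h1 := (measurable_pi_apply j).comp (hη (t - 1) (by omega))
  simp only [coeffMatrix_apply]
  split_ifs
  · exact (measurable_const.add (measurable_const.mul h1)).add h0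
  · exact measurable_const
  · exact measurable_const

theorem measurable_causalTerm_apply (hε : ∀ s ≤ t, Measurable (ε s))
    (hη : ∀ s ≤ t, Measurable (η s)) (k : ℕ) (i : Fin p) :
    Measurable fun ω => causalTerm θ α ε η t k ω i := by
  induction k generalizing t i with
  | zero =>
    simp only [causalTerm_zero, firstVec]
    split_ifs
    · exact hε t le_rfl
    · exact measurable_const
  | succ k ih =>
    simp only [causalTerm_succ, Matrix.mulVec, dotProduct]
    exact Finset.measurable_sum _ fun j _ => (measurable_coeffMatrix_apply θ α hη i j).mul
      (ih (fun s hs => hε s (by omega)) (fun s hs => hη s (by omega)) j)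

/-- `limUnder` of measurable functions is measurable even where the sums diverge. Only noises up to
`t` are required to be measurable, so the σ-algebra may be `F_t` itself. -/
theorem measurable_causalSolution (hε : ∀ s ≤ t, Measurable (ε s))
    (hη : ∀ s ≤ t, Measurable (η s)) (i₀ : Fin p) :
    Measurable (causalSolution θ α ε η i₀ t) :=
  (StronglyMeasurable.limUnder fun _ => (Finset.measurable_sum _ fun k _ =>
    measurable_causalTerm_apply θ α hε hη k i₀).stronglyMeasurable).measurable

theorem measurable_noise_noiseSigma (ε : ℤ → Ω → ℝ) (η : ℤ → Ω → Fin p → ℝ) {s t : ℤ}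
    (hs : s ≤ t) : Measurable[noiseSigma ε η t] fun ω => (ε s ω, η s ω) :=
  measurable_iff_comap_le.2 (le_iSup₂_of_le s hs le_rfl)

end Measurability

/-! ### Convergence of the causal series -/

section Convergence

variable {Ω : Type*} [MeasurableSpace Ω] {μ : Measure Ω} {p : ℕ} {θ α : Fin p → ℝ}
  {ε : ℤ → Ω → ℝ} {η : ℤ → Ω → Fin p → ℝ}

theorem IsNoise.measurable_prodMk (h : IsNoise μ ε η) (t : ℤ) :
    Measurable fun ω => (ε t ω, η t ω) :=
  (h.measurable_eps t).prodMk (h.measurable_eta t)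

variable (θ α) in
/-- The norm of `A_t` is a continuous function of the pair of consecutive noises. -/
theorem continuous_algebraNorm_coeff (nrm : AlgebraNorm ℝ (Matrix (Fin p) (Fin p) ℝ)) :
    Continuous fun x : (ℝ × (Fin p → ℝ)) × (ℝ × (Fin p → ℝ)) =>
      nrm (companion θ + rowMatrix x.1.2 * Matrix.diagonal α + rowMatrix x.2.2) := by
  have hr : Continuous (rowMatrix : (Fin p → ℝ) → _) := by
    refine continuous_matrix fun i j => ?_
    simp only [rowMatrix, Matrix.of_apply]
    split_ifs <;> fun_prop
  refine (continuous_algebraNorm nrm).comp ?_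
  exact (continuous_const.add ((hr.comp (by fun_prop)).matrix_mul continuous_const)).add
    (hr.comp (by fun_prop))

/-- The products `A_t ⋯ A_{t-k+1}` decay exponentially, at a nonrandom rate. -/
theorem exists_coeffProd_decay [IsProbabilityMeasure μ] (hnoise : IsNoise μ ε η)
    (nrm : AlgebraNorm ℝ (Matrix (Fin p) (Fin p) ℝ))
    (hlogA : LogMeanNeg μ (fun ω => nrm (coeffMatrix θ α η 1 ω))) :
    ∃ c > 0, ∃ K ≥ 0, ∀ t, ∀ᵐ ω ∂μ, ∀ᶠ k : ℕ in atTop, ∀ i j,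
      |coeffProd θ α η t k ω i j| ≤ K * Real.exp (-c * k) := by
  have hφ := (continuous_algebraNorm_coeff θ α nrm).measurable
  set φ := fun x : (ℝ × (Fin p → ℝ)) × (ℝ × (Fin p → ℝ)) =>
      nrm (companion θ + rowMatrix x.1.2 * Matrix.diagonal α + rowMatrix x.2.2) with hφdef
  have hA : ∀ t ω, nrm (coeffMatrix θ α η t ω)
      = φ ((ε (t - 1) ω, η (t - 1) ω), (ε t ω, η t ω)) := fun t ω => rfl
  have hm := hnoise.measurable_prodMk
  simp only [hA, sub_self] at hlogA
  obtain ⟨M, hint, hneg⟩ := hlogA.exists_truncation (hφ.comp ((hm 0).prodMk (hm 1)))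
    (fun ω => apply_nonneg _ _)
  -- The decay rate is `-c`, for any `c` strictly between the truncated mean and `0`.
  obtain ⟨c, hc1, hc0⟩ := exists_between hneg
  have hf : Measurable fun x => Real.log (max (φ x) (Real.exp (-M))) :=
    (hφ.max measurable_const).log
  refine ⟨-c, by linarith, (∑ i, ∑ j, nrm (Matrix.single j i 1)) * nrm 1,
    mul_nonneg (sum_nonneg fun i _ => sum_nonneg fun j _ => apply_nonneg _ _) (apply_nonneg _ _),
    fun t => ?_⟩
  filter_upwards [eventually_sum_pair_le hm hnoise.indep hnoise.ident hf hint hc1 t] with ω hω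
  filter_upwards [hω] with k hk i j
  have hprod := algebraNorm_list_prod_le nrm (fun l : ℕ => coeffMatrix θ α η (t - (l : ℤ)) ω)
    (g := fun l : ℕ => Real.log (max (φ ((ε (t - (l : ℤ) - 1) ω, η (t - (l : ℤ) - 1) ω),
      (ε (t - (l : ℤ)) ω, η (t - (l : ℤ)) ω))) (Real.exp (-M)))) (fun l => by
        rw [Real.exp_log (lt_max_of_lt_right (Real.exp_pos _)), hA]
        exact le_max_left _ _) k
  rw [← coeffProd_eq_prod_map] at hprod
  have hij : nrm (Matrix.single j i 1) ≤ ∑ i, ∑ j, nrm (Matrix.single j i (1 : ℝ)) :=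
    (single_le_sum (f := fun j => nrm (Matrix.single j i (1 : ℝ)))
      (fun j _ => apply_nonneg _ _) (mem_univ j)).trans
    (single_le_sum (f := fun i => ∑ j, nrm (Matrix.single j i (1 : ℝ)))
      (fun i _ => sum_nonneg fun j _ => apply_nonneg _ _) (mem_univ i))
  calc |coeffProd θ α η t k ω i j|
      ≤ nrm (Matrix.single j i 1) * nrm (coeffProd θ α η t k ω) := abs_entry_le nrm _ i j
    _ ≤ (∑ i, ∑ j, nrm (Matrix.single j i 1)) * (nrm 1 * Real.exp (c * k)) :=
        mul_le_mul hij (hprod.trans (mul_le_mul_of_nonneg_left (Real.exp_le_exp.2 hk)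
          (apply_nonneg _ _))) (apply_nonneg _ _)
          (sum_nonneg fun i _ => sum_nonneg fun j _ => apply_nonneg _ _)
    _ = _ := by rw [neg_neg, mul_assoc]

/-- The noise grows at most like `exp (c k / 2)`, half the decay rate, which leaves a geometric
majorant. -/
theorem ae_summable_causalTerm [IsProbabilityMeasure μ] (hnoise : IsNoise μ ε η)
    (hlogε : Integrable (fun ω => Real.posLog |ε 0 ω|) μ) {c K : ℝ} (hc : 0 < c) (hK : 0 ≤ K)
    (hdecay : ∀ t, ∀ᵐ ω ∂μ, ∀ᶠ k : ℕ in atTop, ∀ i j,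
      |coeffProd θ α η t k ω i j| ≤ K * Real.exp (-c * k)) :
    ∀ᵐ ω ∂μ, ∀ t, Summable fun k => causalTerm θ α ε η t k ω := by
  refine ae_all_iff.2 fun t => ?_
  have hlog : Measurable fun x : ℝ × (Fin p → ℝ) => Real.posLog |x.1| :=
    measurable_const.max (Real.measurable_log.comp (by fun_prop))
  filter_upwards [hdecay t, eventually_le_mul_nat hnoise.indep hnoise.ident hlog hlogε
    (half_pos hc) t] with ω h1 h2
  refine Pi.summable.2 fun i => ?_
  have i₀ : ∃ i₀ : Fin p, i₀.val = 0 := ⟨⟨0, i.pos⟩, rfl⟩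
  obtain ⟨i₀, h₀⟩ := i₀
  have hgeo : Summable fun k : ℕ => K * Real.exp (-(c / 2)) ^ k :=
    (summable_geometric_of_lt_one (Real.exp_pos _).le
      (Real.exp_lt_one_iff.2 (by linarith))).mul_left K
  refine Summable.of_norm_bounded_eventually_nat hgeo ?_
  filter_upwards [h1, h2] with k hk1 hk2
  rw [causalTerm_apply _ _ _ _ _ _ h₀, norm_mul, Real.norm_eq_abs, Real.norm_eq_abs]
  have he : |ε (t - (k : ℤ)) ω| ≤ Real.exp (c / 2 * k) := by
    rcases eq_or_ne (ε (t - (k : ℤ)) ω) 0 with h | h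
    · rw [h, abs_zero]; exact (Real.exp_pos _).le
    · rw [← Real.log_le_iff_le_exp (abs_pos.2 h)]
      exact (le_max_right _ _).trans hk2
  calc _ ≤ K * Real.exp (-c * k) * Real.exp (c / 2 * k) :=
        mul_le_mul (hk1 i i₀) he (abs_nonneg _) (mul_nonneg hK (Real.exp_pos _).le)
    _ = _ := by
        rw [mul_assoc, ← Real.exp_add, ← Real.exp_nat_mul]
        congr 2
        ring

end Convergence

/-! ### Solutions -/

section Solutions

variable {Ω : Type*} [MeasurableSpace Ω] {μ : Measure Ω} {p : ℕ} {θ α : Fin p → ℝ}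
  {ε : ℤ → Ω → ℝ} {η : ℤ → Ω → Fin p → ℝ} {X : ℤ → Ω → ℝ}

theorem hasCausalRepresentation_of_stateVec_eq
    (hsum : ∀ᵐ ω ∂μ, ∀ t, Summable fun k => causalTerm θ α ε η t k ω)
    (hX : ∀ t, ∀ᵐ ω ∂μ, stateVec p X t ω = ∑' k, causalTerm θ α ε η t k ω) :
    HasCausalRepresentation μ θ α ε η X := by
  intro t
  filter_upwards [hsum, hX t] with ω h1 h2
  exact ⟨(summable_nat_add_iff 1).2 (h1 t), by
    rw [h2, tsum_causalTerm_eq _ _ _ _ _ _ (h1 t)]⟩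

theorem stateVec_causalSolution {i₀ : Fin p} (h₀ : i₀.val = 0)
    (hsum : ∀ᵐ ω ∂μ, ∀ t, Summable fun k => causalTerm θ α ε η t k ω) (t : ℤ) :
    ∀ᵐ ω ∂μ, stateVec p (causalSolution θ α ε η i₀) t ω = ∑' k, causalTerm θ α ε η t k ω := by
  filter_upwards [hsum] with ω h
  funext i
  exact (tsum_causalTerm_apply _ _ _ _ _ _ h₀ h i).symm

theorem isSolution_causalSolution {i₀ : Fin p} (h₀ : i₀.val = 0)
    (hsum : ∀ᵐ ω ∂μ, ∀ t, Summable fun k => causalTerm θ α ε η t k ω) :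
    IsSolution μ θ α ε η (causalSolution θ α ε η i₀) := by
  intro t
  filter_upwards [hsum, stateVec_causalSolution h₀ hsum (t - 1)] with ω h h1
  rw [causalSolution_eq_tsum (h t), tsum_causalTerm_eq _ _ _ _ _ _ (h t),
    tsum_causalTerm_succ _ _ _ _ _ _ (h (t - 1)), ← h1, Pi.add_apply,
    coeffMatrix_mulVec_of_val_eq_zero _ _ _ _ _ _ h₀, add_comm]
  simp [firstVec, h₀, stateVec, sub_sub, add_comm]

/-- A solution satisfies the vector recursion `Φ_t = A_t Φ_{t-1} + E_t`. -/
theorem IsSolution.ae_stateVec_eq (hX : IsSolution μ θ α ε η X) :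
    ∀ᵐ ω ∂μ, ∀ t, stateVec p X t ω
      = (coeffMatrix θ α η t ω).mulVec (stateVec p X (t - 1) ω) + firstVec p (ε t ω) := by
  filter_upwards [ae_all_iff.2 hX] with ω hω t
  funext i
  obtain ⟨n, hn⟩ := i
  cases n with
  | zero =>
    rw [Pi.add_apply, coeffMatrix_mulVec_of_val_eq_zero _ _ _ _ _ _ rfl]
    simp [stateVec, firstVec, hω t, sub_sub, add_comm]
  | succ n =>
    rw [Pi.add_apply, coeffMatrix_mulVec_of_val_eq_succ (j := ⟨n, by omega⟩) _ _ _ _ _ _ rfl]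
    simp [stateVec, firstVec, sub_sub, add_comm]

/-- If the laws of `X_t` are tight, then `X` stays bounded along a random subsequence of past
times with probability close to one. -/
theorem exists_measure_not_frequently_le [IsProbabilityMeasure μ] (hm : ∀ t, Measurable (X t))
    (htight : IsTightMeasureSet (Set.range fun t : ℤ => μ.map (X t))) (p : ℕ) (t : ℤ)
    {δ : ℝ≥0∞} (hδ : 0 < δ) :
    ∃ R : ℝ, μ {ω | ¬ ∃ᶠ n : ℕ in atTop, ∀ j : Fin p,
      |X (t - (n : ℤ) - (j.val : ℤ)) ω| ≤ R} ≤ p * δ := by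
  obtain ⟨C, hC, hle⟩ := isTightMeasureSet_iff_exists_isCompact_measure_compl_le.1 htight δ hδ
  obtain ⟨R, hR⟩ := hC.isBounded.subset_closedBall 0
  refine ⟨R, ?_⟩
  have hbad : ∀ n : ℕ, μ {ω | ¬ ∀ j : Fin p, |X (t - (n : ℤ) - (j.val : ℤ)) ω| ≤ R}
      ≤ p * δ := by
    intro n
    have hsub : {ω | ¬ ∀ j : Fin p, |X (t - (n : ℤ) - (j.val : ℤ)) ω| ≤ R}
        ⊆ ⋃ j : Fin p, X (t - (n : ℤ) - (j.val : ℤ)) ⁻¹' Cᶜ := by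
      intro ω hω
      simp only [Set.mem_ofPred_eq, not_forall] at hω
      obtain ⟨j, hj⟩ := hω
      refine Set.mem_iUnion.2 ⟨j, fun hmem => hj ?_⟩
      simpa using hR hmem
    refine (measure_mono hsub).trans ((measure_iUnion_fintype_le _ _).trans ?_)
    refine (sum_le_sum (g := fun _ => δ) fun j _ => ?_).trans (by simp)
    rw [← Measure.map_apply (hm _) hC.measurableSet.compl]
    exact hle _ ⟨_, rfl⟩
  -- The exceptional set is an increasing union over `N`, each piece lying inside a single bad
  -- event, so the bound does not accumulate.
  have hset : {ω | ¬ ∃ᶠ n : ℕ in atTop, ∀ j : Fin p, |X (t - (n : ℤ) - (j.val : ℤ)) ω| ≤ R}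
      = ⋃ N : ℕ, ⋂ n ≥ N, {ω | ¬ ∀ j : Fin p, |X (t - (n : ℤ) - (j.val : ℤ)) ω| ≤ R} := by
    ext ω
    simp only [Filter.not_frequently, eventually_atTop, Set.mem_ofPred_eq, Set.mem_iUnion,
      Set.mem_iInter]
  rw [hset, Monotone.measure_iUnion]
  · exact iSup_le fun N => (measure_mono (Set.iInter₂_subset N le_rfl)).trans (hbad N)
  · intro N N' hN
    exact Set.biInter_subset_biInter_left fun n hn => le_trans hN hn

/-- The difference with the partial sums converges along all `n`, so smallness of the remainder
along infinitely many `n` identifies its limit as zero. -/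
theorem stateVec_eq_tsum_of_isTight [IsProbabilityMeasure μ] (hm : ∀ t, Measurable (X t))
    (hX : IsSolution μ θ α ε η X)
    (htight : IsTightMeasureSet (Set.range fun t : ℤ => μ.map (X t)))
    (hsum : ∀ᵐ ω ∂μ, ∀ t, Summable fun k => causalTerm θ α ε η t k ω) {c K : ℝ} (hc : 0 < c)
    (hdecay : ∀ t, ∀ᵐ ω ∂μ, ∀ᶠ k : ℕ in atTop, ∀ i j,
      |coeffProd θ α η t k ω i j| ≤ K * Real.exp (-c * k)) (t : ℤ) :
    ∀ᵐ ω ∂μ, stateVec p X t ω = ∑' k, causalTerm θ α ε η t k ω := by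
  have key : ∀ R : ℝ, ∀ᵐ ω ∂μ, (∃ᶠ n : ℕ in atTop, ∀ j : Fin p,
      |X (t - (n : ℤ) - (j.val : ℤ)) ω| ≤ R) →
      stateVec p X t ω = ∑' k, causalTerm θ α ε η t k ω := by
    intro R
    filter_upwards [hX.ae_stateVec_eq, hsum, hdecay t] with ω h1 h2 h3 hfreq
    funext i
    have hlim : Tendsto (fun n : ℕ => stateVec p X t ω i
        - ∑ k ∈ range n, causalTerm θ α ε η t k ω i) atTop
        (𝓝 (stateVec p X t ω i - (∑' k, causalTerm θ α ε η t k ω) i)) :=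
      tendsto_const_nhds.sub (Pi.hasSum.1 (h2 t).hasSum i).tendsto_sum_nat
    have hzero : Tendsto (fun n : ℕ => p * (K * Real.exp (-c * n) * R)) atTop (𝓝 0) := by
      have h : Tendsto (fun n : ℕ => Real.exp (-c * n)) atTop (𝓝 0) :=
        Real.tendsto_exp_atBot.comp
          (tendsto_natCast_atTop_atTop.const_mul_atTop_of_neg (by linarith))
      simpa using ((h.const_mul K).mul_const R).const_mul (p : ℝ)
    refine sub_eq_zero.1 (abs_eq_zero.1 (le_antisymm ?_ (abs_nonneg _)))
    refine le_of_tendsto_of_frequently (hlim.abs.sub hzero |>.trans (by simp)) ?_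
    refine (hfreq.and_eventually h3).mono fun n hn => ?_
    have e := congrFun (eq_sum_causalTerm_add θ α ε η t ω h1 n) i
    rw [Pi.add_apply, Finset.sum_apply] at e
    rw [e, add_sub_cancel_left, sub_nonpos, Matrix.mulVec, dotProduct]
    refine (abs_sum_le_sum_abs _ _).trans ((sum_le_sum (g := fun _ =>
      K * Real.exp (-c * n) * R) fun j _ => ?_).trans (by simp))
    rw [abs_mul]
    exact mul_le_mul (hn.2 i j) (hn.1 j) (abs_nonneg _) ((abs_nonneg _).trans (hn.2 i j))
  rw [ae_iff]
  refine le_antisymm (ENNReal.le_of_forall_pos_le_add fun δ hδ _ => ?_) zero_le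
  -- The choice `δ / (p + 1)` makes the union bound over `p` coordinates at most `δ`, also for `p =
  -- 0`.
  obtain ⟨R, hR⟩ := exists_measure_not_frequently_le hm htight p t
    (δ := δ / (p + 1)) (ENNReal.div_pos (by exact_mod_cast hδ.ne') (by finiteness))
  rw [zero_add]
  refine (measure_mono_ae ?_).trans (hR.trans ?_)
  · filter_upwards [key R] with ω hω hne hf using hne (hω hf)
  · rw [← mul_div_assoc]
    refine ENNReal.div_le_of_le_mul ?_
    rw [mul_comm]
    exact mul_le_mul_right le_self_add _

end Solutions

end RCAR

theorem proposition1 {Ω : Type*} [MeasurableSpace Ω] (μ : Measure Ω) [IsProbabilityMeasure μ]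
    {p : ℕ} (hp : 1 ≤ p) (θ α : Fin p → ℝ)
    (ε : ℤ → Ω → ℝ) (η : ℤ → Ω → Fin p → ℝ) (hnoise : RCAR.IsNoise μ ε η)
    (nrm : AlgebraNorm ℝ (Matrix (Fin p) (Fin p) ℝ))
    (hlogA : RCAR.LogMeanNeg μ (fun ω => nrm (RCAR.coeffMatrix θ α η 1 ω)))
    (hlogε : Integrable (fun ω => Real.posLog |ε 0 ω|) μ) :
    (∃ X : ℤ → Ω → ℝ,
      (∀ t, Measurable[RCAR.noiseSigma ε η t] (X t)) ∧
      RCAR.IsSolution μ θ α ε η X ∧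
      RCAR.HasCausalRepresentation μ θ α ε η X ∧
      RCAR.IsStrictlyStationary μ X ∧
      RCAR.IsErgodicProcess μ X) ∧
    (∀ X : ℤ → Ω → ℝ,
      (∀ t, Measurable (X t)) →
      RCAR.IsSolution μ θ α ε η X →
      IsTightMeasureSet (Set.range fun t : ℤ => μ.map (X t)) →
      RCAR.HasCausalRepresentation μ θ α ε η X ∧
      (∀ t, AEStronglyMeasurable[RCAR.noiseSigma ε η t] (X t) μ) ∧
      RCAR.IsStrictlyStationary μ X ∧
      RCAR.IsErgodicProcess μ X) := by
  obtain ⟨c, hc, K, hK, hdecay⟩ := RCAR.exists_coeffProd_decay hnoise nrm hlogA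
  have hsum := RCAR.ae_summable_causalTerm hnoise hlogε hc hK hdecay
  let i₀ : Fin p := ⟨0, hp⟩
  have h₀ : i₀.val = 0 := rfl
  have hadapted : ∀ t, Measurable[RCAR.noiseSigma ε η t] (RCAR.causalSolution θ α ε η i₀ t) :=
    fun t => RCAR.measurable_causalSolution (m := RCAR.noiseSigma ε η t) θ α
      (fun s hs => measurable_fst.comp (RCAR.measurable_noise_noiseSigma ε η hs))
      (fun s hs => measurable_snd.comp (RCAR.measurable_noise_noiseSigma ε η hs)) i₀
  have hfactor : Measurable (RCAR.causalSolution θ α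
      (fun s (x : ℤ → ℝ × (Fin p → ℝ)) => (x s).1) (fun s x => (x s).2) i₀ 0) :=
    RCAR.measurable_causalSolution θ α (fun s _ => by fun_prop) (fun s _ => by fun_prop) i₀
  have hstat : ∀ X : ℤ → Ω → ℝ, (∀ t, X t =ᵐ[μ] RCAR.causalSolution θ α ε η i₀ t) →
      RCAR.IsStrictlyStationary μ X ∧ RCAR.IsErgodicProcess μ X := by
    intro X hX
    have hX' : ∀ t, X t =ᵐ[μ] fun ω => RCAR.causalSolution θ α
        (fun s (x : ℤ → ℝ × (Fin p → ℝ)) => (x s).1) (fun s x => (x s).2) i₀ 0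
        (fun s => (ε (s + t) ω, η (s + t) ω)) := fun t => by
      filter_upwards [hX t] with ω hω
      rw [hω, RCAR.causalSolution_path]
    exact ⟨RCAR.isStrictlyStationary_of_ae_eq_factor hnoise.measurable_prodMk hnoise.indep
        hnoise.ident hfactor hX',
      RCAR.isErgodicProcess_of_ae_eq_factor hnoise.measurable_prodMk hnoise.indep
        hnoise.ident hfactor hX'⟩
  refine ⟨⟨RCAR.causalSolution θ α ε η i₀, hadapted, RCAR.isSolution_causalSolution h₀ hsum,
    RCAR.hasCausalRepresentation_of_stateVec_eq hsum (RCAR.stateVec_causalSolution h₀ hsum),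
    hstat _ fun t => ae_eq_refl _⟩, fun X hm hX htight => ?_⟩
  have hstate := RCAR.stateVec_eq_tsum_of_isTight hm hX htight hsum hc hdecay
  -- `X t` is the first coordinate of the state vector, so it agrees almost surely with the causal
  -- solution.
  have hae : ∀ t, X t =ᵐ[μ] RCAR.causalSolution θ α ε η i₀ t := by
    intro t
    filter_upwards [hstate t, hsum] with ω h1 h2
    rw [RCAR.causalSolution_eq_tsum (h2 t), ← h1]
    simp [RCAR.stateVec, i₀]
  exact ⟨RCAR.hasCausalRepresentation_of_stateVec_eq hsum hstate,
    fun t => ⟨_, (hadapted t).stronglyMeasurable, hae t⟩, hstat X hae⟩
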